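/- Let $\mathcal S$ and $\mathcal A$ be finite sets with at least two elements each, let $\gamma\in(0,1)$, let $\tau:\mathcal S\times\mathcal A\to\Delta(\mathcal S)$ be any transition function and $\mu_0\in\Delta(\mathcal S)$ any initial state distribution. A reward function is a map $R:\mathcal S\times\mathcal A\times\mathcal S\to\mathbb R$, $\mathcal R$ is the space of reward functions, and a policy is a map $\pi:\mathcal S\to\Delta(\mathcal A)$. Write $J_i(\pi)=\mathbb E\big[\sum_{t\ge 0}\gamma^tR_i(s_t,a_t,s_{t+1})\big]$ for the expected discounted return of $R_i$ along trajectories with $s_0\sim\mu_0$, $a_t\sim\pi(s_t)$, $s_{t+1}\sim\tau(s_t,a_t)$. A function $d:\mathcal R\times\mathcal R\to\mathbb R$ is *sound* if there is a constant $U>0$ such that for all $R_1,R_2\in\mathcal R$ and all policies $\pi_1,\pi_2$ with $J_2(\pi_2)\ge J_2(\pi_1)$, $$J_1(\pi_1)-J_1(\pi_2)\le U\cdot\big(\max_\pi J_1(\pi)-\min_\pi J_1(\pi)\big)\cdot d(R_1,R_2).$$ The pair $(R_1,R_2)$ has *maximal normalised regret* if $\max_\pi J_1(\pi)-\min_\pi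 J_1(\pi)>0$ and there are policies $\pi_1,\pi_2$ with $J_2(\pi_2)\ge J_2(\pi_1)$ and $$\frac{J_1(\pi_1)-J_1(\pi_2)}{\max_\pi J_1(\pi)-\min_\pi J_1(\pi)}=1.$$ *EPIC.* Let $\mathcal D_{\mathcal S}\in\Delta(\mathcal S)$ and $\mathcal D_{\mathcal A}\in\Delta(\mathcal A)$ have full support, and let $S,S'\sim\mathcal D_{\mathcal S}$ and $A\sim\mathcal D_{\mathcal A}$ be independent. Put $$C(R)(s,a,s')=R(s,a,s')+\mathbb E\big[\gamma R(s',A,S')-R(s,A,S')-\gamma R(S,A,S')\big].$$ The EPIC distance is the Pearson distance $D^{\mathrm{EPIC}}(R_1,R_2)=\sqrt{(1-\rho)/2}$, where $\rho$ is the Pearson correlation of $C(R_1)(S,A,S')$ and $C(R_2)(S,A,S')$; if $\rho$ is undefined because a variance vanishes, the distance is $0$ when both variances vanish and $1/2$ when exactly one does. *EPIC-like metrics.* Two reward functions differ by potential shaping if $R_2(s,a,s')=R_1(s,a,s')+\gamma\Phi(s')-\Phi(s)$ for some $\Phi:\mathcal S\to\mathbb R$. A linear map $c:\mathcal R\to\mathcal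 R$ is an EPIC-like canonicalisation function if $R$ and $c(R)$ always differ by potential shaping, and $c(R_1)=c(R_2)$ if and only if $R_1$ and $R_2$ differ by potential shaping. An EPIC-like metric is a function of the form $d(R_1,R_2)=m(s(R_1),s(R_2))$, where $c$ is an EPIC-like canonicalisation function, $n$ is a norm on $\mathrm{Im}(c)$, $m$ is a metric on $\mathrm{Im}(c)$ such that $\ell\,p(x-y)\le m(x,y)\le u\,p(x-y)$ for some norm $p$ on $\mathrm{Im}(c)$ and constants $\ell,u>0$, and $s(R)=c(R)/n(c(R))$ if $n(c(R))\ne0$, $s(R)=c(R)$ otherwise. **Theorem.** (1) For all $\mathcal D_{\mathcal S},\mathcal D_{\mathcal A}$ with full support, $D^{\mathrm{EPIC}}$ is not sound; moreover, for every $\delta>0$ there are reward functions $R_1,R_2$ with maximal normalised regret, for which $C(R_1)(S,A,S')$ and $C(R_2)(S,A,S')$ have nonzero variance, and with $D^{\mathrm{EPIC}}(R_1,R_2)<\delta$. (2) No EPIC-like metric $d$ is sound; moreover, for every $\delta>0$ there are reward functions $R_1,R_2$ with maximal normalised regret and $d(R_1,R_2)<\delta$. -/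

import Mathlib

open MeasureTheory ProbabilityTheory

noncomputable section

namespace RewardComparison

/-- Reward functions `R : S × A × S → ℝ`. -/
abbrev Reward (S A : Type*) : Type _ := S → A → S → ℝ

/-- (Stationary, stochastic) policies. -/
abbrev Policy (S A : Type*) : Type _ := S → PMF A

section Environment

variable {S A : Type*}
  [Finite S] [MeasurableSpace S] [MeasurableSingletonClass S]
  [Finite A] [MeasurableSpace A] [MeasurableSingletonClass A]

/-- The joint law of a state `s ∼ ν` and an action `a ∼ π(s)`. -/
def withAction (π : Policy S A) (ν : PMF S) : PMF (S × A) :=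
  ν.bind fun s => (π s).map fun a => (s, a)

/-- One step of the state-action chain: from `(s, a)` move to `s' ∼ τ(s, a)`, then draw
`a' ∼ π(s')`. -/
def stepKernel (τ : S → A → PMF S) (π : Policy S A) : Kernel (S × A) (S × A) where
  toFun x := (withAction π (τ x.1 x.2)).toMeasure
  measurable' := measurable_of_countable _

instance (τ : S → A → PMF S) (π : Policy S A) : IsMarkovKernel (stepKernel τ π) :=
  ⟨fun x => PMF.toMeasure.isProbabilityMeasure (withAction π (τ x.1 x.2))⟩

/-- The step kernel as a kernel on histories up to time `n`; it only looks at the last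
state-action pair. -/
def historyKernel (τ : S → A → PMF S) (π : Policy S A) (n : ℕ) :
    Kernel (Π _ : Finset.Iic n, S × A) (S × A) :=
  (stepKernel τ π).comap (fun h => h ⟨n, Finset.mem_Iic.2 le_rfl⟩) (measurable_pi_apply _)

instance (τ : S → A → PMF S) (π : Policy S A) (n : ℕ) : IsMarkovKernel (historyKernel τ π n) :=
  inferInstanceAs (IsMarkovKernel ((stepKernel τ π).comap _ _))

/-- The law of the trajectory `(s₀, a₀), (s₁, a₁), …` where `s₀ ∼ μ₀`, `aₜ ∼ π(sₜ)` and
`sₜ₊₁ ∼ τ(sₜ, aₜ)`. -/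
def trajectoryLaw (τ : S → A → PMF S) (μ₀ : PMF S) (π : Policy S A) : Measure (ℕ → S × A) :=
  Kernel.trajMeasure (X := fun _ => S × A) (withAction π μ₀).toMeasure (historyKernel τ π)

/-- The return `G(ξ) = ∑ₜ γ^t R(sₜ, aₜ, sₜ₊₁)`. -/
def discountedReturn (γ : ℝ) (R : Reward S A) (ξ : ℕ → S × A) : ℝ :=
  ∑' t, γ ^ t * R (ξ t).1 (ξ t).2 (ξ (t + 1)).1

/-- The evaluation function `J(π)`, the expected return. -/
def evalPolicy (γ : ℝ) (τ : S → A → PMF S) (μ₀ : PMF S) (R : Reward S A) (π : Policy S A) : ℝ :=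
  ∫ ξ, discountedReturn γ R ξ ∂(trajectoryLaw τ μ₀ π)

/-- `max_π J(π) - min_π J(π)`. -/
def evalRange (γ : ℝ) (τ : S → A → PMF S) (μ₀ : PMF S) (R : Reward S A) : ℝ :=
  (⨆ π : Policy S A, evalPolicy γ τ μ₀ R π) - ⨅ π : Policy S A, evalPolicy γ τ μ₀ R π

/-- Soundness of a function `d` on pairs of rewards, in the environment `(γ, τ, μ₀)`. -/
def IsSound (γ : ℝ) (τ : S → A → PMF S) (μ₀ : PMF S) (d : Reward S A → Reward S A → ℝ) : Prop :=
  ∃ U : ℝ, 0 < U ∧ ∀ (R₁ R₂ : Reward S A) (π₁ π₂ : Policy S A),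
    evalPolicy γ τ μ₀ R₂ π₁ ≤ evalPolicy γ τ μ₀ R₂ π₂ →
      evalPolicy γ τ μ₀ R₁ π₁ - evalPolicy γ τ μ₀ R₁ π₂ ≤ U * evalRange γ τ μ₀ R₁ * d R₁ R₂

/-- The normalised regret of `(R₁, R₂)` is maximal: `R₁` is not constant on policies, and some
policy `π₂` that `R₂` weakly prefers to `π₁` loses all of the range of `J₁`. -/
def HasMaximalRegret (γ : ℝ) (τ : S → A → PMF S) (μ₀ : PMF S) (R₁ R₂ : Reward S A) : Prop :=
  0 < evalRange γ τ μ₀ R₁ ∧ ∃ π₁ π₂ : Policy S A,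
    evalPolicy γ τ μ₀ R₂ π₁ ≤ evalPolicy γ τ μ₀ R₂ π₂ ∧
    (evalPolicy γ τ μ₀ R₁ π₁ - evalPolicy γ τ μ₀ R₁ π₂) / evalRange γ τ μ₀ R₁ = 1

end Environment

section Abstract

/-- `n` is a norm on the real vector space `V`. -/
structure IsNorm {V : Type*} [AddCommGroup V] [Module ℝ V] (n : V → ℝ) : Prop where
  nonneg : ∀ v, 0 ≤ n v
  eq_zero_iff : ∀ v, n v = 0 ↔ v = 0
  smul : ∀ (a : ℝ) (v : V), n (a • v) = |a| * n v
  sub_le : ∀ v w, n (v - w) ≤ n v + n w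

/-- `m` is a metric on `X`. -/
structure IsMetric {X : Type*} (m : X → X → ℝ) : Prop where
  nonneg : ∀ x y, 0 ≤ m x y
  eq_zero_iff : ∀ x y, m x y = 0 ↔ x = y
  symm : ∀ x y, m x y = m y x
  triangle : ∀ x y z, m x z ≤ m x y + m y z

/-- An admissible metric: a metric that is bilipschitz equivalent to a norm. -/
def IsAdmissible {V : Type*} [AddCommGroup V] [Module ℝ V] (m : V → V → ℝ) : Prop :=
  IsMetric m ∧ ∃ p : V → ℝ, IsNorm p ∧ ∃ l u : ℝ, 0 < l ∧ 0 < u ∧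
    ∀ x y, l * p (x - y) ≤ m x y ∧ m x y ≤ u * p (x - y)

/-- Division of `v` by `n v`, if that is nonzero. -/
def normalise {V : Type*} [AddCommGroup V] [Module ℝ V] (n : V → ℝ) (v : V) : V :=
  open Classical in if n v ≠ 0 then (n v)⁻¹ • v else v

end Abstract

section EPICLike

variable {S A : Type*}

/-- `R₂` is produced by potential shaping of `R₁`. -/
def DifferByPotential (γ : ℝ) (R₁ R₂ : Reward S A) : Prop :=
  ∃ Φ : S → ℝ, ∀ s a s', R₂ s a s' = R₁ s a s' + γ * Φ s' - Φ s

/-- EPIC-like canonicalisation functions (linearity is in the type). -/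
def IsEPICLikeCanonicalisation (γ : ℝ) (c : Reward S A →ₗ[ℝ] Reward S A) : Prop :=
  (∀ R, DifferByPotential γ R (c R)) ∧
    ∀ R₁ R₂, c R₁ = c R₂ ↔ DifferByPotential γ R₁ R₂

/-- EPIC-like metrics: `d(R₁, R₂) = m(s(R₁), s(R₂))` where `s` is canonicalisation by `c` followed
by division by `n`, for a norm `n` and an admissible metric `m` on the image of `c`. -/
def IsEPICLikeMetric (γ : ℝ) (d : Reward S A → Reward S A → ℝ) : Prop :=
  ∃ c : Reward S A →ₗ[ℝ] Reward S A, IsEPICLikeCanonicalisation γ c ∧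
    ∃ n : LinearMap.range c → ℝ, IsNorm n ∧
      ∃ m : LinearMap.range c → LinearMap.range c → ℝ, IsAdmissible m ∧
        ∀ R₁ R₂, d R₁ R₂ = m (normalise n (c.rangeRestrict R₁)) (normalise n (c.rangeRestrict R₂))

end EPICLike

section EPIC

variable {S A : Type*} [MeasurableSpace S] [MeasurableSpace A]

/-- The law of `(S, A, S')` with independent `S, S' ∼ DS` and `A ∼ DA`. -/
def coverage (DS : PMF S) (DA : PMF A) : Measure (S × A × S) :=
  DS.toMeasure.prod (DA.toMeasure.prod DS.toMeasure)

/-- `C(R)(s,a,s') = R(s,a,s') + E[γ R(s',A,S') - R(s,A,S') - γ R(S,A,S')]`. -/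
def epicCanon (γ : ℝ) (DS : PMF S) (DA : PMF A) (R : Reward S A) : Reward S A :=
  fun s a s' => R s a s' +
    ∫ t, (γ * R s' t.2.1 t.2.2 - R s t.2.1 t.2.2 - γ * R t.1 t.2.1 t.2.2) ∂(coverage DS DA)

/-- The random variable `C(R)(S, A, S')`. -/
def epicVar (γ : ℝ) (DS : PMF S) (DA : PMF A) (R : Reward S A) : S × A × S → ℝ :=
  fun t => epicCanon γ DS DA R t.1 t.2.1 t.2.2

/-- The Pearson correlation of two random variables. -/
def pearsonCorrelation {Ω : Type*} [MeasurableSpace Ω] (X Y : Ω → ℝ) (μ : Measure Ω) : ℝ :=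
  covariance X Y μ / (√(variance X μ) * √(variance Y μ))

/-- The Pearson distance `√((1 - ρ) / 2)`. The correlation `ρ` is undefined if one of the variances
vanishes; the distance is then `0` if both vanish and `1/2` otherwise, which is what the expression
`½ ‖X/‖X‖ - Y/‖Y‖‖` in the `L²`-norm gives for centred variables, with `X/‖X‖` read as `0` if
`‖X‖ = 0`. -/
def pearsonDistance {Ω : Type*} [MeasurableSpace Ω] (X Y : Ω → ℝ) (μ : Measure Ω) : ℝ :=
  open Classical in
  if variance X μ = 0 ∧ variance Y μ = 0 then 0
  else if variance X μ = 0 ∨ variance Y μ = 0 then 1 / 2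
  else √((1 - pearsonCorrelation X Y μ) / 2)

/-- The EPIC distance. -/
def epicDistance (γ : ℝ) (DS : PMF S) (DA : PMF A) (R₁ R₂ : Reward S A) : ℝ :=
  pearsonDistance (epicVar γ DS DA R₁) (epicVar γ DS DA R₂) (coverage DS DA)

end EPIC

end RewardComparison

end

open RewardComparison

/-!
Evaluation `J` is linear in the reward, so a reward `H` with `J(H) = 0` for every policy can be added
to any reward without affecting its policy order. The surprise `g(s') - E[g(S')]`,
`S' ∼ τ(s, a)`, of the successor state has this property by the Markov property of trajectories
(`evalPolicy_surpriseReward`), but paid for a single action and with nonconstant `g` it is not a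
potential shaping of `0` (`not_differByPotential_surpriseReward`): the other actions force the
potential to vanish.

Let `K` be the reward `1` for that action and `0` for the others. Its values `J(K)` lie in
`[0, (1 - γ)⁻¹]`, and the constant policies attain both ends. For every `ε > 0` the rewards `H + εK`
and `H - εK` therefore order the policies oppositely and have maximal normalised regret
(`hasMaximalRegret_add_smul`). As `ε → 0` both tend to `H`, and both kinds of distance, which
standardise a canonicalised reward, are continuous along lines through `H`, since the
canonicalisation of `H` is not degenerate (`tendsto_pearsonDistance_add_smul` with
`variance_epicVar_ne_zero`, and `tendsto_epicLikeMetric`). Hence the distances tend to `0`.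

A sound `d` with constant `U` satisfies `d ≥ 1 / U` at maximal normalised regret, so it cannot have
this property (`not_isSound_of_hasMaximalRegret`).
-/

open RewardComparison

namespace RewardComparison

open Filter Topology

/-! ### A reward without effect on policies, and a reward for one action -/

section TwoRewards

variable {S A : Type*}

/-- The reward for action `a` given by the surprise `g(s') - E[g(S')]`, `S' ∼ τ(s, a)`, of the
observed successor state; all other actions get `0`. -/
noncomputable def surpriseReward [MeasurableSpace S] [DecidableEq A] (τ : S → A → PMF S) (a : A)
    (g : S → ℝ) : Reward S A :=
  fun s b s' => if b = a then g s' - ∫ x, g x ∂(τ s b).toMeasure else 0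

/-- The reward `1` for action `a` and `0` for all others. -/
def actionReward [DecidableEq A] (a : A) : Reward S A := fun _ b _ => if b = a then 1 else 0

theorem not_differByPotential_surpriseReward [MeasurableSpace S] [Nontrivial A] [DecidableEq A]
    {γ : ℝ} (hγ1 : γ < 1) (τ : S → A → PMF S) (a : A) {g : S → ℝ} {s₀ s₁ : S}
    (hg : g s₀ ≠ g s₁) :
    ¬ DifferByPotential γ 0 (surpriseReward τ a g) := by
  rintro ⟨Φ, hΦ⟩
  obtain ⟨b, hb⟩ := exists_ne a
  -- An action `b ≠ a` has reward `0`, so that `γ Φ(s') = Φ(s)` for all `s`, `s'`, including `s' = s`.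
  have hzero : ∀ s, Φ s = 0 := fun s => by
    have h := hΦ s b s
    simp only [surpriseReward, hb, if_false, Pi.zero_apply] at h
    have h' : (γ - 1) * Φ s = 0 := by linarith
    exact (mul_eq_zero.1 h').resolve_left (by linarith)
  -- The reward for `a` would then be `0`, and `g` would be constant.
  have h0 := hΦ s₀ a s₀
  have h1 := hΦ s₀ a s₁
  simp only [surpriseReward, if_true, Pi.zero_apply, hzero] at h0 h1
  exact hg (by linarith)

end TwoRewards

/-! ### Marginals of a state-action pair -/

section WithAction

variable {S A : Type*}

theorem map_fst_withAction (π : Policy S A) (ν : PMF S) :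
    (withAction π ν).map Prod.fst = ν := by
  simp only [withAction, PMF.map_bind, PMF.map_comp, Function.comp_def]
  exact (congrArg ν.bind (funext fun s => PMF.map_const _ s)).trans (PMF.bind_pure ν)

theorem integral_withAction_fst [Finite S] [MeasurableSpace S] [MeasurableSingletonClass S]
    [MeasurableSpace A] (π : Policy S A) (ν : PMF S) (g : S → ℝ) :
    ∫ x, g x.1 ∂(withAction π ν).toMeasure = ∫ s, g s ∂ν.toMeasure := by
  conv_rhs =>
    rw [← map_fst_withAction π ν,
      ← PMF.toMeasure_map (f := Prod.fst) (withAction π ν) measurable_fst]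
  exact (integral_map measurable_fst.aemeasurable
    (measurable_of_countable g).aestronglyMeasurable).symm

theorem integral_withAction_pure [MeasurableSpace S] [Finite A] [MeasurableSpace A]
    [MeasurableSingletonClass A] (a : A) (ν : PMF S) (f : A → ℝ) :
    ∫ x, f x.2 ∂(withAction (fun _ => PMF.pure a) ν).toMeasure = f a := by
  have h : (withAction (fun _ => PMF.pure a) ν).map Prod.snd = PMF.pure a := by
    simp [withAction, PMF.map_bind, PMF.pure_map]
  have h' := integral_map (μ := (withAction (fun _ => PMF.pure a) ν).toMeasure)
    measurable_snd.aemeasurable (f := f) (measurable_of_countable f).aestronglyMeasurable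
  rw [PMF.toMeasure_map (f := Prod.snd) _ measurable_snd, h, PMF.toMeasure_pure,
    integral_dirac] at h'
  exact h'.symm

end WithAction

/-! ### Expected return along trajectories -/

theorem exists_reward_bound {S A : Type*} [Finite S] [Finite A] (R : Reward S A) :
    ∃ C : ℝ, ∀ s a s', |R s a s'| ≤ C := by
  obtain ⟨C, hC⟩ := (Set.finite_range fun x : S × A × S => |R x.1 x.2.1 x.2.2|).bddAbove
  exact ⟨C, fun s a s' => hC ⟨(s, a, s'), rfl⟩⟩

section Environment

variable {S A : Type*}
  [Finite S] [MeasurableSpace S] [MeasurableSingletonClass S]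
  [Finite A] [MeasurableSpace A] [MeasurableSingletonClass A]

instance isProbabilityMeasure_trajectoryLaw (τ : S → A → PMF S) (μ₀ : PMF S) (π : Policy S A) :
    IsProbabilityMeasure (trajectoryLaw τ μ₀ π) :=
  inferInstanceAs (IsProbabilityMeasure (Kernel.trajMeasure (X := fun _ => S × A) _ _))

theorem map_eval_zero_trajectoryLaw (τ : S → A → PMF S) (μ₀ : PMF S) (π : Policy S A) :
    (trajectoryLaw τ μ₀ π).map (fun ξ => ξ 0) = (withAction π μ₀).toMeasure := by
  have h : (trajectoryLaw τ μ₀ π).map (Preorder.frestrictLe 0) =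
      (withAction π μ₀).toMeasure.map
        (MeasurableEquiv.piUnique (fun _ : Finset.Iic 0 => S × A)).symm := by
    rw [trajectoryLaw, Kernel.trajMeasure, Measure.map_comp _ _ (by fun_prop),
      Kernel.traj_map_frestrictLe, Kernel.partialTraj_self, Measure.id_comp]
  have h2 : (fun ξ : ℕ → S × A => ξ 0) =
      (MeasurableEquiv.piUnique (fun _ : Finset.Iic 0 => S × A)) ∘ Preorder.frestrictLe 0 := rfl
  rw [h2, ← Measure.map_map (MeasurableEquiv.measurable _) (by fun_prop), h,
    MeasurableEquiv.map_map_symm]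

/-- The Markov property of the trajectory, for functions of two consecutive state-action pairs. -/
theorem integral_trajectoryLaw_succ (τ : S → A → PMF S) (μ₀ : PMF S) (π : Policy S A) (t : ℕ)
    (f : S × A → S × A → ℝ) :
    ∫ ξ, f (ξ t) (ξ (t + 1)) ∂(trajectoryLaw τ μ₀ π) =
      ∫ ξ, ∫ y, f (ξ t) y ∂(withAction π (τ (ξ t).1 (ξ t).2)).toMeasure
        ∂(trajectoryLaw τ μ₀ π) := by
  have hf : Measurable fun p : (Π _ : Finset.Iic t, S × A) × (S × A) =>
      f (p.1 ⟨t, Finset.mem_Iic.2 le_rfl⟩) p.2 := measurable_of_countable _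
  have hkey := Kernel.map_frestrictLe_trajMeasure_compProd_eq_map_trajMeasure
    (X := fun _ => S × A) (μ₀ := (withAction π μ₀).toMeasure) (κ := historyKernel τ π) (a := t)
  change (trajectoryLaw τ μ₀ π).map _ ⊗ₘ _ = (trajectoryLaw τ μ₀ π).map _ at hkey
  have h1 := integral_map (μ := trajectoryLaw τ μ₀ π)
    (φ := fun x => (Preorder.frestrictLe (π := fun _ => S × A) t x, x (t + 1)))
    (by fun_prop) hf.aestronglyMeasurable
  rw [← hkey, Measure.integral_compProd, integral_map (by fun_prop)] at h1
  · exact h1.symm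
  · exact (measurable_of_countable _).aestronglyMeasurable
  · have : IsProbabilityMeasure ((trajectoryLaw τ μ₀ π).map
        (Preorder.frestrictLe (π := fun _ => S × A) t)) :=
      Measure.isProbabilityMeasure_map (by fun_prop)
    exact Integrable.of_finite

/-- The expected reward `E[R(sₜ, aₜ, sₜ₊₁)]` collected at time `t`. -/
noncomputable def stageReward (τ : S → A → PMF S) (μ₀ : PMF S) (R : Reward S A) (π : Policy S A)
    (t : ℕ) : ℝ :=
  ∫ ξ, R (ξ t).1 (ξ t).2 (ξ (t + 1)).1 ∂(trajectoryLaw τ μ₀ π)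

theorem integrable_reward (τ : S → A → PMF S) (μ₀ : PMF S) (R : Reward S A) (π : Policy S A)
    (t : ℕ) :
    Integrable (fun ξ => R (ξ t).1 (ξ t).2 (ξ (t + 1)).1) (trajectoryLaw τ μ₀ π) := by
  obtain ⟨C, hC⟩ := exists_reward_bound R
  have hR : Measurable fun x : S × A × S => R x.1 x.2.1 x.2.2 := measurable_of_countable _
  have hξ : Measurable fun ξ : ℕ → S × A => ((ξ t).1, (ξ t).2, (ξ (t + 1)).1) := by fun_prop
  exact Integrable.of_bound (hR.comp hξ).aestronglyMeasurable C
    (Filter.Eventually.of_forall fun ξ => hC _ _ _)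

theorem abs_stageReward_le {C : ℝ} (τ : S → A → PMF S) (μ₀ : PMF S) {R : Reward S A}
    (hC : ∀ s a s', |R s a s'| ≤ C) (π : Policy S A) (t : ℕ) :
    |stageReward τ μ₀ R π t| ≤ C := by
  simpa [stageReward] using norm_integral_le_of_norm_le_const (μ := trajectoryLaw τ μ₀ π)
    (f := fun ξ => R (ξ t).1 (ξ t).2 (ξ (t + 1)).1)
    (Filter.Eventually.of_forall fun ξ => hC _ _ _)

theorem stageReward_add_smul (τ : S → A → PMF S) (μ₀ : PMF S) (R₁ R₂ : Reward S A) (c : ℝ)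
    (π : Policy S A) (t : ℕ) :
    stageReward τ μ₀ (R₁ + c • R₂) π t =
      stageReward τ μ₀ R₁ π t + c * stageReward τ μ₀ R₂ π t := by
  simp only [stageReward, Pi.add_apply, Pi.smul_apply, smul_eq_mul]
  rw [integral_add (integrable_reward τ μ₀ R₁ π t) ((integrable_reward τ μ₀ R₂ π t).const_mul c),
    integral_const_mul]

theorem summable_stageReward {γ : ℝ} (hγ0 : 0 < γ) (hγ1 : γ < 1) (τ : S → A → PMF S) (μ₀ : PMF S)
    (R : Reward S A) (π : Policy S A) :
    Summable fun t => γ ^ t * stageReward τ μ₀ R π t := by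
  obtain ⟨C, hC⟩ := exists_reward_bound R
  refine Summable.of_norm_bounded ((summable_geometric_of_lt_one hγ0.le hγ1).mul_right C) ?_
  intro t
  rw [norm_mul, norm_pow, Real.norm_of_nonneg hγ0.le]
  exact mul_le_mul_of_nonneg_left (abs_stageReward_le τ μ₀ hC π t) (by positivity)

theorem evalPolicy_eq_tsum {γ : ℝ} (hγ0 : 0 < γ) (hγ1 : γ < 1) (τ : S → A → PMF S) (μ₀ : PMF S)
    (R : Reward S A) (π : Policy S A) :
    evalPolicy γ τ μ₀ R π = ∑' t, γ ^ t * stageReward τ μ₀ R π t := by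
  have h := hasSum_integral_of_summable_integral_norm (μ := trajectoryLaw τ μ₀ π)
    (F := fun t ξ => γ ^ t * R (ξ t).1 (ξ t).2 (ξ (t + 1)).1)
    (fun t => (integrable_reward τ μ₀ R π t).const_mul _) ?_
  · simpa only [integral_const_mul, evalPolicy, discountedReturn, stageReward] using h.tsum_eq.symm
  · refine (summable_stageReward hγ0 hγ1 τ μ₀ (fun s a s' => |R s a s'|) π).congr fun t => ?_
    simp only [norm_mul, norm_pow, Real.norm_of_nonneg hγ0.le, integral_const_mul, stageReward,
      Real.norm_eq_abs]

theorem evalPolicy_add_smul {γ : ℝ} (hγ0 : 0 < γ) (hγ1 : γ < 1) (τ : S → A → PMF S) (μ₀ : PMF S)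
    (R₁ R₂ : Reward S A) (c : ℝ) (π : Policy S A) :
    evalPolicy γ τ μ₀ (R₁ + c • R₂) π = evalPolicy γ τ μ₀ R₁ π + c * evalPolicy γ τ μ₀ R₂ π := by
  simp only [evalPolicy_eq_tsum hγ0 hγ1, stageReward_add_smul]
  rw [← tsum_mul_left, ← (summable_stageReward hγ0 hγ1 τ μ₀ R₁ π).tsum_add
    ((summable_stageReward hγ0 hγ1 τ μ₀ R₂ π).mul_left c)]
  exact tsum_congr fun t => by ring

theorem evalPolicy_of_stageReward_eq {γ c : ℝ} (hγ0 : 0 < γ) (hγ1 : γ < 1) {τ : S → A → PMF S}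
    {μ₀ : PMF S} {R : Reward S A} {π : Policy S A} (h : ∀ t, stageReward τ μ₀ R π t = c) :
    evalPolicy γ τ μ₀ R π = (1 - γ)⁻¹ * c := by
  simp only [evalPolicy_eq_tsum hγ0 hγ1, h]
  rw [tsum_mul_right, tsum_geometric_of_lt_one hγ0.le hγ1]

/-! ### Evaluation of the two rewards -/

theorem evalPolicy_surpriseReward [DecidableEq A] {γ : ℝ} (hγ0 : 0 < γ) (hγ1 : γ < 1)
    (τ : S → A → PMF S) (μ₀ : PMF S) (a : A) (g : S → ℝ) (π : Policy S A) :
    evalPolicy γ τ μ₀ (surpriseReward τ a g) π = 0 := by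
  rw [evalPolicy_of_stageReward_eq hγ0 hγ1 (c := 0), mul_zero]
  intro t
  rw [stageReward,
    integral_trajectoryLaw_succ τ μ₀ π t fun x y => surpriseReward τ a g x.1 x.2 y.1]
  refine integral_eq_zero_of_ae (Filter.Eventually.of_forall fun ξ => ?_)
  refine (integral_withAction_fst π _ fun s' => surpriseReward τ a g (ξ t).1 (ξ t).2 s').trans ?_
  by_cases h : (ξ t).2 = a
  · simp only [surpriseReward, h, if_true]
    rw [integral_sub Integrable.of_finite (integrable_const _)]
    simp
  · simp [surpriseReward, h]

theorem stageReward_pure (τ : S → A → PMF S) (μ₀ : PMF S) (f : A → ℝ) (a : A) (t : ℕ) :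
    stageReward τ μ₀ (fun _ b _ => f b) (fun _ => PMF.pure a) t = f a := by
  cases t with
  | zero =>
    rw [stageReward, ← integral_withAction_pure a μ₀ f, ← map_eval_zero_trajectoryLaw τ,
      integral_map (measurable_pi_apply 0).aemeasurable
        (measurable_of_countable fun x : S × A => f x.2).aestronglyMeasurable]
  | succ t =>
    change ∫ ξ, f (ξ (t + 1)).2 ∂(trajectoryLaw τ μ₀ _) = f a
    rw [integral_trajectoryLaw_succ τ μ₀ _ t fun _ y => f y.2]
    simp only [integral_withAction_pure]
    simp

theorem evalPolicy_actionReward_pure [DecidableEq A] {γ : ℝ} (hγ0 : 0 < γ) (hγ1 : γ < 1)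
    (τ : S → A → PMF S) (μ₀ : PMF S) (a b : A) :
    evalPolicy γ τ μ₀ (actionReward a) (fun _ => PMF.pure b) =
      (1 - γ)⁻¹ * if b = a then 1 else 0 :=
  evalPolicy_of_stageReward_eq hγ0 hγ1 fun t =>
    stageReward_pure τ μ₀ (fun b => if b = a then 1 else 0) b t

theorem evalPolicy_actionReward_mem_Icc [DecidableEq A] {γ : ℝ} (hγ0 : 0 < γ) (hγ1 : γ < 1)
    (τ : S → A → PMF S) (μ₀ : PMF S) (a : A) (π : Policy S A) :
    evalPolicy γ τ μ₀ (actionReward a) π ∈ Set.Icc 0 (1 - γ)⁻¹ := by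
  have h0 : ∀ t, 0 ≤ stageReward τ μ₀ (actionReward a) π t := fun t =>
    integral_nonneg fun ξ => by simp only [actionReward]; split_ifs <;> simp
  have h1 : ∀ t, stageReward τ μ₀ (actionReward a) π t ≤ 1 := fun t =>
    (le_abs_self _).trans (abs_stageReward_le τ μ₀
      (fun s b s' => by simp only [actionReward]; split_ifs <;> simp) π t)
  rw [evalPolicy_eq_tsum hγ0 hγ1]
  refine ⟨tsum_nonneg fun t => mul_nonneg (by positivity) (h0 t), ?_⟩
  rw [← tsum_geometric_of_lt_one hγ0.le hγ1]
  exact (summable_stageReward hγ0 hγ1 τ μ₀ _ π).tsum_le_tsum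
    (fun t => mul_le_of_le_one_right (by positivity) (h1 t))
    (summable_geometric_of_lt_one hγ0.le hγ1)

/-! ### Maximal normalised regret -/

/-- If `J(H) = 0` for all policies, then `H + εK` and `H - εK` order the policies oppositely,
however small `ε > 0` is. -/
theorem hasMaximalRegret_add_smul {γ : ℝ} (hγ0 : 0 < γ) (hγ1 : γ < 1) (τ : S → A → PMF S)
    (μ₀ : PMF S) {H K : Reward S A} (hH : ∀ π, evalPolicy γ τ μ₀ H π = 0)
    {π₁ π₂ : Policy S A} (hlt : evalPolicy γ τ μ₀ K π₂ < evalPolicy γ τ μ₀ K π₁)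
    (hmax : ∀ π, evalPolicy γ τ μ₀ K π ≤ evalPolicy γ τ μ₀ K π₁)
    (hmin : ∀ π, evalPolicy γ τ μ₀ K π₂ ≤ evalPolicy γ τ μ₀ K π) {ε : ℝ} (hε : 0 < ε) :
    HasMaximalRegret γ τ μ₀ (H + ε • K) (H + (-ε) • K) := by
  have hJ : ∀ c π, evalPolicy γ τ μ₀ (H + c • K) π = c * evalPolicy γ τ μ₀ K π := fun c π => by
    rw [evalPolicy_add_smul hγ0 hγ1, hH, zero_add]
  have hsup : IsGreatest (Set.range (evalPolicy γ τ μ₀ (H + ε • K)))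
      (ε * evalPolicy γ τ μ₀ K π₁) :=
    ⟨⟨π₁, hJ ε π₁⟩, by rintro _ ⟨π, rfl⟩; rw [hJ]; exact mul_le_mul_of_nonneg_left (hmax π) hε.le⟩
  have hinf : IsLeast (Set.range (evalPolicy γ τ μ₀ (H + ε • K)))
      (ε * evalPolicy γ τ μ₀ K π₂) :=
    ⟨⟨π₂, hJ ε π₂⟩, by rintro _ ⟨π, rfl⟩; rw [hJ]; exact mul_le_mul_of_nonneg_left (hmin π) hε.le⟩
  have hrange : evalRange γ τ μ₀ (H + ε • K) =
      ε * evalPolicy γ τ μ₀ K π₁ - ε * evalPolicy γ τ μ₀ K π₂ := by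
    rw [evalRange, iSup, iInf, hsup.csSup_eq, hinf.csInf_eq]
  have hpos : 0 < ε * evalPolicy γ τ μ₀ K π₁ - ε * evalPolicy γ τ μ₀ K π₂ :=
    sub_pos.2 (mul_lt_mul_of_pos_left hlt hε)
  refine ⟨hrange ▸ hpos, π₁, π₂, ?_, ?_⟩
  · rw [hJ, hJ]
    linarith
  · rw [hrange, hJ, hJ, div_self hpos.ne']

theorem exists_forall_hasMaximalRegret [Nontrivial S] [Nontrivial A] {γ : ℝ} (hγ0 : 0 < γ)
    (hγ1 : γ < 1) (τ : S → A → PMF S) (μ₀ : PMF S) :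
    ∃ H K : Reward S A, ¬ DifferByPotential γ 0 H ∧
      ∀ ε : ℝ, 0 < ε → HasMaximalRegret γ τ μ₀ (H + ε • K) (H + (-ε) • K) := by
  classical
  obtain ⟨s₀, s₁, hs⟩ := exists_pair_ne S
  obtain ⟨a₀, a₁, ha⟩ := exists_pair_ne A
  have hpos : 0 < (1 - γ)⁻¹ := inv_pos.2 (by linarith)
  have h₀ := evalPolicy_actionReward_pure hγ0 hγ1 τ μ₀ a₀ a₀
  have h₁ := evalPolicy_actionReward_pure hγ0 hγ1 τ μ₀ a₀ a₁
  rw [if_pos rfl, mul_one] at h₀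
  rw [if_neg ha.symm, mul_zero] at h₁
  refine ⟨surpriseReward τ a₀ (Pi.single s₀ 1), actionReward a₀,
    not_differByPotential_surpriseReward hγ1 τ a₀ (s₀ := s₀) (s₁ := s₁) (by simp [hs.symm]),
    fun ε hε => hasMaximalRegret_add_smul hγ0 hγ1 τ μ₀
      (evalPolicy_surpriseReward hγ0 hγ1 τ μ₀ a₀ _) (π₁ := fun _ => PMF.pure a₀)
      (π₂ := fun _ => PMF.pure a₁) (by rwa [h₀, h₁]) (fun π => ?_) (fun π => ?_) hε⟩
  · rw [h₀]
    exact (evalPolicy_actionReward_mem_Icc hγ0 hγ1 τ μ₀ a₀ π).2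
  · rw [h₁]
    exact (evalPolicy_actionReward_mem_Icc hγ0 hγ1 τ μ₀ a₀ π).1

/-- A sound function is bounded below by `1 / U` on pairs of maximal normalised regret. -/
theorem not_isSound_of_hasMaximalRegret {γ : ℝ} {τ : S → A → PMF S} {μ₀ : PMF S}
    {d : Reward S A → Reward S A → ℝ}
    (h : ∀ δ : ℝ, 0 < δ → ∃ R₁ R₂, HasMaximalRegret γ τ μ₀ R₁ R₂ ∧ d R₁ R₂ < δ) :
    ¬ IsSound γ τ μ₀ d := by
  rintro ⟨U, hU, hsound⟩
  obtain ⟨R₁, R₂, ⟨hpos, π₁, π₂, hle, hreg⟩, hd⟩ := h U⁻¹ (inv_pos.2 hU)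
  have hb := hsound R₁ R₂ π₁ π₂ hle
  rw [(div_eq_one_iff_eq hpos.ne').1 hreg] at hb
  have hlt : U * evalRange γ τ μ₀ R₁ * d R₁ R₂ < U * evalRange γ τ μ₀ R₁ * U⁻¹ :=
    mul_lt_mul_of_pos_left hd (mul_pos hU hpos)
  have heq : U * evalRange γ τ μ₀ R₁ * U⁻¹ = evalRange γ τ μ₀ R₁ := by field_simp
  linarith

end Environment

/-! ### EPIC-like metrics near a nonzero canonicalised reward -/

section Abstract

variable {V : Type*} [AddCommGroup V] [Module ℝ V]

theorem IsNorm.abs_add_smul_sub_le {n : V → ℝ} (hn : IsNorm n) (v w : V) (ε : ℝ) :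
    |n (v + ε • w) - n v| ≤ |ε| * n w := by
  have h1 := hn.sub_le v ((-ε) • w)
  have h2 := hn.sub_le (v + ε • w) (ε • w)
  rw [hn.smul, abs_neg, neg_smul, sub_neg_eq_add] at h1
  rw [hn.smul, add_sub_cancel_right] at h2
  rw [abs_sub_le_iff]
  constructor <;> linarith

theorem IsNorm.tendsto_add_smul {n : V → ℝ} (hn : IsNorm n) (v w : V) :
    Tendsto (fun ε : ℝ => n (v + ε • w)) (𝓝 0) (𝓝 (n v)) := by
  rw [tendsto_iff_norm_sub_tendsto_zero]
  refine squeeze_zero (fun _ => norm_nonneg _) (fun ε => hn.abs_add_smul_sub_le v w ε) ?_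
  have : Continuous fun ε : ℝ => |ε| * n w := by fun_prop
  simpa using this.tendsto 0

/-- Away from `0`, normalisation is continuous along lines with respect to an admissible metric. -/
theorem tendsto_normalise_add_smul {n : V → ℝ} (hn : IsNorm n) {m : V → V → ℝ}
    (hm : IsAdmissible m) {v : V} (hv : v ≠ 0) (w : V) :
    Tendsto (fun ε : ℝ => m (normalise n (v + ε • w)) (normalise n (v + (-ε) • w)))
      (𝓝 0) (𝓝 0) := by
  obtain ⟨hmet, p, hp, l, u, -, hu, hlu⟩ := hm
  have hnv : n v ≠ 0 := mt (hn.eq_zero_iff v).1 hv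
  have hplus := hn.tendsto_add_smul v w
  have hminus : Tendsto (fun ε : ℝ => n (v + (-ε) • w)) (𝓝 0) (𝓝 (n v)) :=
    hplus.comp (by simpa using (continuous_neg (G := ℝ)).tendsto 0)
  have hbound : ∀ᶠ ε : ℝ in 𝓝 0,
      m (normalise n (v + ε • w)) (normalise n (v + (-ε) • w)) ≤
        u * (|(n (v + ε • w))⁻¹ - (n (v + (-ε) • w))⁻¹| * p v +
          |-(((n (v + ε • w))⁻¹ + (n (v + (-ε) • w))⁻¹) * ε)| * p w) := by
    filter_upwards [hplus.eventually_ne hnv, hminus.eventually_ne hnv] with ε h1 h2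
    refine (hlu _ _).2.trans (mul_le_mul_of_nonneg_left ?_ hu.le)
    rw [normalise, normalise, if_pos h1, if_pos h2]
    generalize (n (v + ε • w))⁻¹ = x
    generalize (n (v + (-ε) • w))⁻¹ = y
    -- Split the difference into its part along `v`, where only the normalising factors differ, and
    -- its part along `w`, which carries a factor `ε`.
    have h := hp.sub_le ((x - y) • v) ((-((x + y) * ε)) • w)
    rw [hp.smul, hp.smul] at h
    have hxy : x • (v + ε • w) - y • (v + (-ε) • w) =
        (x - y) • v - (-((x + y) * ε)) • w := by module
    rwa [hxy]
  refine squeeze_zero' (Eventually.of_forall fun _ => hmet.nonneg _ _) hbound ?_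
  have hx := hplus.inv₀ hnv
  have hy := hminus.inv₀ hnv
  have h := (((hx.sub hy).abs.mul_const (p v)).add
    ((((hx.add hy).mul (tendsto_id (α := ℝ))).neg).abs.mul_const (p w))).const_mul u
  simpa using h

end Abstract

section EPICLike

variable {S A : Type*}

/-- The canonicalisation of `H` is nonzero as `H` is not a potential shaping of `0`, so the division
by `n` is harmless near `H`. -/
theorem tendsto_epicLikeMetric {γ : ℝ} {d : Reward S A → Reward S A → ℝ}
    (hd : IsEPICLikeMetric γ d) {H : Reward S A} (hH : ¬ DifferByPotential γ 0 H)
    (K : Reward S A) :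
    Tendsto (fun ε : ℝ => d (H + ε • K) (H + (-ε) • K)) (𝓝 0) (𝓝 0) := by
  obtain ⟨c, hc, n, hn, m, hm, hd⟩ := hd
  have hv : c.rangeRestrict H ≠ 0 := fun h =>
    hH ((hc.2 0 H).1 (by simpa using (congrArg Subtype.val h).symm))
  simp only [hd, map_add, map_smul]
  exact tendsto_normalise_add_smul hn hm hv _

end EPICLike

/-! ### Pearson distance near a nondegenerate random variable -/

section Pearson

variable {Ω : Type*} [MeasurableSpace Ω] {μ : Measure Ω} [IsProbabilityMeasure μ] {X Y : Ω → ℝ}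

theorem covariance_add_smul_add_smul (hX : MemLp X 2 μ) (hY : MemLp Y 2 μ) (a b : ℝ) :
    covariance (X + a • Y) (X + b • Y) μ =
      covariance X X μ + (a + b) * covariance X Y μ + a * b * covariance Y Y μ := by
  rw [covariance_add_left hX (hY.const_smul a) (hX.add (hY.const_smul b)),
    covariance_add_right hX hX (hY.const_smul b),
    covariance_add_right (hY.const_smul a) hX (hY.const_smul b)]
  simp only [covariance_smul_left, covariance_smul_right, covariance_comm Y X]
  ring

theorem tendsto_variance_add_smul (hX : MemLp X 2 μ) (hY : MemLp Y 2 μ) :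
    Tendsto (fun ε : ℝ => variance (X + ε • Y) μ) (𝓝 0) (𝓝 (variance X μ)) := by
  have hc : Continuous fun ε : ℝ =>
      covariance X X μ + (ε + ε) * covariance X Y μ + ε * ε * covariance Y Y μ := by fun_prop
  have h := hc.tendsto 0
  simp only [← covariance_add_smul_add_smul hX hY] at h
  have hv : ∀ ε : ℝ, covariance (X + ε • Y) (X + ε • Y) μ = variance (X + ε • Y) μ := fun ε =>
    covariance_self (hX.add (hY.const_smul ε)).aestronglyMeasurable.aemeasurable
  rw [hv] at h
  simpa only [hv, zero_smul, add_zero] using h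

/-- The covariance and both variances tend to the variance of `X`, so the correlation tends to `1`
and, near `ε = 0`, is defined. -/
theorem tendsto_pearsonDistance_add_smul (hX : MemLp X 2 μ) (hY : MemLp Y 2 μ)
    (hvar : variance X μ ≠ 0) :
    Tendsto (fun ε : ℝ => pearsonDistance (X + ε • Y) (X + (-ε) • Y) μ) (𝓝 0) (𝓝 0) := by
  have hplus := tendsto_variance_add_smul hX hY
  have hminus : Tendsto (fun ε : ℝ => variance (X + (-ε) • Y) μ) (𝓝 0) (𝓝 (variance X μ)) :=
    hplus.comp (by simpa using (continuous_neg (G := ℝ)).tendsto 0)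
  have hcov : Tendsto (fun ε : ℝ => covariance (X + ε • Y) (X + (-ε) • Y) μ) (𝓝 0)
      (𝓝 (variance X μ)) := by
    have hc : Continuous fun ε : ℝ =>
        covariance X X μ + (ε + -ε) * covariance X Y μ + ε * -ε * covariance Y Y μ := by fun_prop
    have h := hc.tendsto 0
    simp only [← covariance_add_smul_add_smul hX hY] at h
    simpa [covariance_self hX.aestronglyMeasurable.aemeasurable] using h
  have hsqrt : √(variance X μ) * √(variance X μ) = variance X μ :=
    Real.mul_self_sqrt (variance_nonneg X μ)
  have hlim : Tendsto
      (fun ε : ℝ => √((1 - pearsonCorrelation (X + ε • Y) (X + (-ε) • Y) μ) / 2))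
      (𝓝 0) (𝓝 0) := by
    have h := (((hcov.div (hplus.sqrt.mul hminus.sqrt) (by rwa [hsqrt])).const_sub 1).div_const
      2).sqrt
    simpa [pearsonCorrelation, hsqrt, div_self hvar] using h
  refine hlim.congr' ?_
  filter_upwards [hplus.eventually_ne hvar, hminus.eventually_ne hvar] with ε h1 h2
  rw [pearsonDistance, if_neg fun h => h1 h.1, if_neg fun h => h.elim h1 h2]

end Pearson

/-! ### The EPIC distance -/

section EPIC

variable {S A : Type*}
  [Finite S] [MeasurableSpace S] [MeasurableSingletonClass S]
  [Finite A] [MeasurableSpace A] [MeasurableSingletonClass A]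

instance isProbabilityMeasure_coverage (DS : PMF S) (DA : PMF A) :
    IsProbabilityMeasure (coverage DS DA) :=
  inferInstanceAs (IsProbabilityMeasure (DS.toMeasure.prod (DA.toMeasure.prod DS.toMeasure)))

theorem forall_of_ae_coverage {DS : PMF S} {DA : PMF A} (hDS : ∀ s, DS s ≠ 0)
    (hDA : ∀ a, DA a ≠ 0) {p : S × A × S → Prop} (h : ∀ᵐ t ∂(coverage DS DA), p t) (t) : p t := by
  by_contra ht
  have h0 : coverage DS DA ({t.1} ×ˢ {t.2.1} ×ˢ {t.2.2}) = 0 :=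
    measure_mono_null (by rintro ⟨s, a, s'⟩ ⟨rfl, rfl, rfl⟩; exact ht) (ae_iff.1 h)
  rw [coverage, Measure.prod_prod, Measure.prod_prod] at h0
  simp [PMF.toMeasure_apply_singleton, hDS, hDA] at h0

theorem epicVar_add_smul (γ : ℝ) (DS : PMF S) (DA : PMF A) (R₁ R₂ : Reward S A) (c : ℝ) :
    epicVar γ DS DA (R₁ + c • R₂) = epicVar γ DS DA R₁ + c • epicVar γ DS DA R₂ := by
  ext ⟨s, a, s'⟩
  simp only [epicVar, epicCanon, Pi.add_apply, Pi.smul_apply, smul_eq_mul]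
  rw [mul_add, ← integral_const_mul, add_add_add_comm,
    ← integral_add Integrable.of_finite Integrable.of_finite]
  congr 2
  ext t
  ring

/-- Up to an additive constant, `C(R)` is a potential shaping of `R`, and constants are potential
shapings of `0`. Hence `C(R)(S, A, S')` is degenerate only if `R` is a potential shaping of `0`. -/
theorem variance_epicVar_ne_zero {γ : ℝ} (hγ1 : γ < 1) {DS : PMF S} {DA : PMF A}
    (hDS : ∀ s, DS s ≠ 0) (hDA : ∀ a, DA a ≠ 0) {R : Reward S A}
    (hR : ¬ DifferByPotential γ 0 R) :
    variance (epicVar γ DS DA R) (coverage DS DA) ≠ 0 := by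
  intro hvar
  have hL : MemLp (epicVar γ DS DA R) 2 (coverage DS DA) := MemLp.of_discrete
  rw [variance, ENNReal.toReal_eq_zero_iff, or_iff_left hL.evariance_ne_top,
    evariance_eq_zero_iff hL.aestronglyMeasurable.aemeasurable] at hvar
  have hconst := forall_of_ae_coverage hDS hDA hvar
  set k := ∫ t, epicVar γ DS DA R t ∂(coverage DS DA)
  set e := ∫ t, γ * R t.1 t.2.1 t.2.2 ∂(coverage DS DA)
  let ψ : S → ℝ := fun s => ∫ t, R s t.2.1 t.2.2 ∂(coverage DS DA)
  -- `C(R) = k` reads `R(s,a,s') = k + e + ψ(s) - γ ψ(s')`, and `k + e` is the shaping of `0` by a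
  -- constant potential.
  refine hR ⟨fun s => (k + e) / (γ - 1) - ψ s, fun s a s' => ?_⟩
  have h := hconst (s, a, s')
  simp only [epicVar, epicCanon] at h
  rw [integral_sub Integrable.of_finite Integrable.of_finite,
    integral_sub Integrable.of_finite Integrable.of_finite, integral_const_mul] at h
  change R s a s' + (γ * ψ s' - ψ s - e) = k at h
  have hγ : γ - 1 ≠ 0 := by linarith
  have hk : γ * ((k + e) / (γ - 1)) - (k + e) / (γ - 1) = k + e := by field_simp
  simp only [Pi.zero_apply]
  linarith

end EPIC

/-! ### Small distance at maximal normalised regret -/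

section Environment

variable {S A : Type*}
  [Finite S] [Nontrivial S] [MeasurableSpace S] [MeasurableSingletonClass S]
  [Finite A] [Nontrivial A] [MeasurableSpace A] [MeasurableSingletonClass A]

theorem exists_hasMaximalRegret_epicDistance_lt {γ : ℝ} (hγ0 : 0 < γ) (hγ1 : γ < 1)
    (τ : S → A → PMF S) (μ₀ : PMF S) {DS : PMF S} {DA : PMF A} (hDS : ∀ s, DS s ≠ 0)
    (hDA : ∀ a, DA a ≠ 0) {δ : ℝ} (hδ : 0 < δ) :
    ∃ R₁ R₂ : Reward S A,
      variance (epicVar γ DS DA R₁) (coverage DS DA) ≠ 0 ∧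
      variance (epicVar γ DS DA R₂) (coverage DS DA) ≠ 0 ∧
      HasMaximalRegret γ τ μ₀ R₁ R₂ ∧ epicDistance γ DS DA R₁ R₂ < δ := by
  obtain ⟨H, K, hH, hreg⟩ := exists_forall_hasMaximalRegret (S := S) (A := A) hγ0 hγ1 τ μ₀
  have hpos : ∀ᶠ ε : ℝ in 𝓝[>] 0, 0 < ε := self_mem_nhdsWithin
  have hX : MemLp (epicVar γ DS DA H) 2 (coverage DS DA) := MemLp.of_discrete
  have hY : MemLp (epicVar γ DS DA K) 2 (coverage DS DA) := MemLp.of_discrete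
  have hvar := variance_epicVar_ne_zero hγ1 hDS hDA hH
  have hv := (tendsto_variance_add_smul hX hY).eventually_ne hvar
  have hneg : Tendsto (fun ε : ℝ => -ε) (𝓝 0) (𝓝 0) := by
    simpa using (continuous_neg (G := ℝ)).tendsto 0
  have hd := (tendsto_pearsonDistance_add_smul hX hY hvar).eventually_lt_const hδ
  obtain ⟨ε, hε, h⟩ :=
    (hpos.and (nhdsWithin_le_nhds (hv.and ((hneg.eventually hv).and hd)))).exists
  simp only [← epicVar_add_smul] at h
  exact ⟨_, _, h.1, h.2.1, hreg ε hε, h.2.2⟩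

theorem exists_hasMaximalRegret_epicLikeMetric_lt {γ : ℝ} (hγ0 : 0 < γ) (hγ1 : γ < 1)
    (τ : S → A → PMF S) (μ₀ : PMF S) {d : Reward S A → Reward S A → ℝ}
    (hd : IsEPICLikeMetric γ d) {δ : ℝ} (hδ : 0 < δ) :
    ∃ R₁ R₂ : Reward S A, HasMaximalRegret γ τ μ₀ R₁ R₂ ∧ d R₁ R₂ < δ := by
  obtain ⟨H, K, hH, hreg⟩ := exists_forall_hasMaximalRegret (S := S) (A := A) hγ0 hγ1 τ μ₀
  have hpos : ∀ᶠ ε : ℝ in 𝓝[>] 0, 0 < ε := self_mem_nhdsWithin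
  have hlt := (tendsto_epicLikeMetric hd hH K).eventually_lt_const hδ
  obtain ⟨ε, hε, h⟩ := (hpos.and (nhdsWithin_le_nhds hlt)).exists
  exact ⟨_, _, hreg ε hε, h⟩

end Environment

end RewardComparison

theorem mainTheorem6 {S A : Type*}
    [Finite S] [Nontrivial S] [MeasurableSpace S] [MeasurableSingletonClass S]
    [Finite A] [Nontrivial A] [MeasurableSpace A] [MeasurableSingletonClass A]
    (γ : ℝ) (hγ0 : 0 < γ) (hγ1 : γ < 1) (τ : S → A → PMF S) (μ₀ : PMF S) :
    (∀ (DS : PMF S) (DA : PMF A), (∀ s, DS s ≠ 0) → (∀ a, DA a ≠ 0) →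
      ¬ IsSound γ τ μ₀ (epicDistance γ DS DA) ∧
      ∀ δ : ℝ, 0 < δ → ∃ R₁ R₂ : Reward S A,
        variance (epicVar γ DS DA R₁) (coverage DS DA) ≠ 0 ∧
        variance (epicVar γ DS DA R₂) (coverage DS DA) ≠ 0 ∧
        HasMaximalRegret γ τ μ₀ R₁ R₂ ∧ epicDistance γ DS DA R₁ R₂ < δ) ∧
    (∀ d : Reward S A → Reward S A → ℝ, IsEPICLikeMetric γ d →
      ¬ IsSound γ τ μ₀ d ∧
      ∀ δ : ℝ, 0 < δ → ∃ R₁ R₂ : Reward S A,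
        HasMaximalRegret γ τ μ₀ R₁ R₂ ∧ d R₁ R₂ < δ) := by
  refine ⟨fun DS DA hDS hDA => ⟨not_isSound_of_hasMaximalRegret fun δ hδ => ?_, fun δ hδ =>
    exists_hasMaximalRegret_epicDistance_lt hγ0 hγ1 τ μ₀ hDS hDA hδ⟩,
    fun d hd => ⟨not_isSound_of_hasMaximalRegret fun δ hδ => ?_, fun δ hδ =>
      exists_hasMaximalRegret_epicLikeMetric_lt hγ0 hγ1 τ μ₀ hd hδ⟩⟩
  · obtain ⟨R₁, R₂, -, -, h⟩ :=
      exists_hasMaximalRegret_epicDistance_lt hγ0 hγ1 τ μ₀ hDS hDA hδ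
    exact ⟨R₁, R₂, h⟩
  · exact exists_hasMaximalRegret_epicLikeMetric_lt hγ0 hγ1 τ μ₀ hd hδ
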